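/- For a finite graph $G$ and an integer $k\ge 1$, call $G$ equitably $k$-choosable if for every list assignment $L$ that gives each vertex $v\in V(G)$ a set $L(v)$ of exactly $k$ colors, there is a proper coloring $c$ of $G$ with $c(v)\in L(v)$ for every $v$ such that every color is used on at most $\lceil |V(G)|/k\rceil$ vertices. For $n\ge 3$, let $\Pi_n = C_n\,\square\, K_2$ be the prism graph, the Cartesian product of the $n$-cycle $C_n$ and the complete graph $K_2$; it has $2n$ vertices. **Theorem.** For every $n\ge 3$, the prism graph $\Pi_n$ is equitably $3$-choosable. That is, for every assignment $L$ of $3$-element lists to the vertices of $\Pi_n$, there is a proper coloring of $\Pi_n$ from the lists $L$ in which every color class has at most $\lceil 2n/3\rceil$ vertices. -/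

import Mathlib

/-- A list assignment `L` on the vertices is `k`-uniform if every list has exactly `k` colors. -/
def IsUniformListAssignment {V : Type*} {α : Type*} (L : V → Finset α) (k : ℕ) : Prop :=
  ∀ v, (L v).card = k

/-- A coloring is `m`-bounded if each of its color classes has at most `m` vertices. -/
def IsBoundedColoring {V : Type*} [Finite V] {α : Type*} {G : SimpleGraph V}
    (c : G.Coloring α) (m : ℕ) : Prop :=
  ∀ a : α, (c.colorClass a).ncard ≤ m

universe u w

/-- A finite graph `G` is equitably `k`-choosable if every `k`-uniform list assignment `L`
(with colors from an arbitrary set) admits a proper coloring `c` (an element of `G.Coloring α`)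
with `c v ∈ L v` for every vertex `v`, in which every color class has at most `⌈|V(G)| / k⌉`
vertices. -/
def EquitablyChoosable {V : Type u} [Finite V] (G : SimpleGraph V) (k : ℕ) : Prop :=
  ∀ (α : Type w) (L : V → Finset α), IsUniformListAssignment L k →
    ∃ c : G.Coloring α, (∀ v, c v ∈ L v) ∧ IsBoundedColoring c ⌈(Nat.card V : ℚ) / (k : ℚ)⌉₊

/-- The `n`-prism: the Cartesian product of the cycle `C_n` (for `n ≥ 3`) with `K_2`. -/
def prismGraph (n : ℕ) : SimpleGraph (Fin n × Fin 2) :=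
  SimpleGraph.boxProd (SimpleGraph.cycleGraph n) (SimpleGraph.completeGraph (Fin 2))

open MvPolynomial in
/-- The product of the differences `X u - X v` over the edges `(u, v)` in a list. -/
noncomputable def edgePolynomial {σ : Type*} (R : Type*) [CommRing R] (E : List (σ × σ)) :
    MvPolynomial σ R :=
  (E.map fun e => X e.1 - X e.2).prod

/-- The coefficient of the monomial with exponents `d` in the product of the differences
`X u - X v` over the edges `(u, v)` in a list. -/
def edgeCoeff {σ : Type*} [Fintype σ] [DecidableEq σ] : List (σ × σ) → (σ → ℕ) → ℤ
  | [], d => if ∀ i, d i = 0 then 1 else 0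
  | (u, v) :: E, d =>
      (if d u = 0 then 0 else edgeCoeff E fun w => if w = u then d w - 1 else d w) -
        (if d v = 0 then 0 else edgeCoeff E fun w => if w = v then d w - 1 else d w)

open MvPolynomial in
lemma coeff_edgePolynomial {σ : Type*} [Fintype σ] [DecidableEq σ] (R : Type*) [CommRing R]
    (E : List (σ × σ)) (t : σ →₀ ℕ) :
    coeff t (edgePolynomial R E) = (edgeCoeff E t : R) := by
  induction E generalizing t with
  | nil =>
    have : (0 = t) ↔ ∀ i, t i = 0 := by rw [eq_comm, Finsupp.ext_iff]; rfl
    simp [edgePolynomial, edgeCoeff, coeff_one, this]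
  | cons e E ih =>
    obtain ⟨u, v⟩ := e
    have hX (s : σ) : coeff t (X s * edgePolynomial R E) =
        ((if t s = 0 then 0 else edgeCoeff E fun w => if w = s then t w - 1 else t w : ℤ) : R) := by
      rw [coeff_X_mul']
      by_cases h : t s = 0
      · simp [h]
      · have hd : ((t - Finsupp.single s 1 : σ →₀ ℕ) : σ → ℕ) = fun w => if w = s then t w - 1 else t w := by
          ext w
          by_cases hw : w = s
          · simp [hw]
          · simp [hw]
        rw [if_pos (by simpa using h), if_neg h, ih, hd]
    have : edgePolynomial R ((u, v) :: E) =
        X u * edgePolynomial R E - X v * edgePolynomial R E := by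
      simp [edgePolynomial, sub_mul]
    rw [this, coeff_sub, hX, hX, edgeCoeff]
    push_cast
    rfl

open MvPolynomial in
lemma isHomogeneous_edgePolynomial {σ : Type*} (R : Type*) [CommRing R] (E : List (σ × σ)) :
    (edgePolynomial R E).IsHomogeneous E.length := by
  induction E with
  | nil => simpa [edgePolynomial] using isHomogeneous_one σ R
  | cons e E ih =>
    have := ((isHomogeneous_X R e.1).sub (isHomogeneous_X R e.2)).mul ih
    simpa [edgePolynomial, add_comm] using this

open MvPolynomial in
/-- The Alon–Tarsi theorem: if the graph polynomial has a nonzero coefficient at the monomial with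
exponents `d`, then the graph is colorable from lists of sizes larger than `d`. -/
theorem exists_listColoring_of_edgeCoeff_ne_zero {σ : Type*} [Fintype σ] [DecidableEq σ]
    {α : Type*} (E : List (σ × σ)) (d : σ → ℕ) (hd : edgeCoeff E d ≠ 0) (S : σ → Finset α)
    (hS : ∀ i, d i < (S i).card) :
    ∃ c : σ → α, (∀ i, c i ∈ S i) ∧ ∀ e ∈ E, c e.1 ≠ c e.2 := by
  classical
  let R := MvPolynomial α ℤ
  let t : σ →₀ ℕ := Finsupp.equivFunOnFinite.symm d
  have ht : coeff t (edgePolynomial R E) ≠ 0 := by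
    rw [coeff_edgePolynomial]
    exact_mod_cast hd
  have hhom := isHomogeneous_edgePolynomial R E
  have hdeg : (edgePolynomial R E).totalDegree = t.degree := by
    rw [hhom.totalDegree (ne_zero_iff.mpr ⟨t, ht⟩)]
    by_contra h
    exact ht (hhom.coeff_eq_zero (Ne.symm h))
  have hX : Function.Injective (X : α → R) := X_injective
  obtain ⟨s, hs, hne⟩ := combinatorial_nullstellensatz_exists_eval_nonzero _ t ht hdeg
    (fun i => (S i).image X) fun i => by
      rw [Finset.card_image_of_injective _ hX]
      exact hS i
  simp only [Finset.mem_image] at hs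
  choose c hc hcs using hs
  refine ⟨c, hc, fun e he heq => hne ?_⟩
  rw [edgePolynomial, map_list_prod, List.map_map, List.prod_eq_zero_iff, List.mem_map]
  exact ⟨e, he, by simp [← hcs, heq]⟩

/-- The pairs `(u, v)` with `u < v` that are related by `r`, sorted by `v`. -/
def edgeList (N : ℕ) (r : ℕ → ℕ → Bool) : List (Fin N × Fin N) :=
  (List.finRange N).flatMap fun v : Fin N =>
    ((List.finRange N).filter fun u : Fin N => decide (u < v) && r u v).map fun u => (u, v)

lemma exists_listColoring_of_edgeList {α : Type*} [Nonempty α] (N : ℕ) (r : ℕ → ℕ → Bool)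
    (d : List ℕ) (hd : edgeCoeff (edgeList N r) (fun i => d.getD i 0) ≠ 0) (S : ℕ → Finset α)
    (hS : ∀ i < N, d.getD i 0 < (S i).card) :
    ∃ c : ℕ → α, (∀ i < N, c i ∈ S i) ∧ ∀ u v, u < v → v < N → r u v → c u ≠ c v := by
  obtain ⟨c, hc, hE⟩ := exists_listColoring_of_edgeCoeff_ne_zero _ _ hd (fun i => S i)
    fun i => hS i i.isLt
  refine ⟨fun i => if h : i < N then c ⟨i, h⟩ else Classical.arbitrary α,
    fun i hi => ?_, fun u v huv hv hr => ?_⟩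
  · simpa [hi] using hc ⟨i, hi⟩
  · have hu := huv.trans hv
    simpa [hu, hv] using hE (⟨u, hu⟩, ⟨v, hv⟩) (by simp [edgeList, huv, hr])

/-- Adjacency `u ~ v`, for `u < v`, in the one-way infinite ladder whose `i`-th rung joins `2 * i`
and `2 * i + 1`. -/
def ladderAdj (u v : ℕ) : Bool := v == u + 2 || (v == u + 1 && u % 2 == 0)

lemma ladderAdj_iff {u v : ℕ} : ladderAdj u v ↔ v = u + 2 ∨ (v = u + 1 ∧ u % 2 = 0) := by
  simp [ladderAdj]

lemma edgeCoeff_ladder_three :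
    edgeCoeff (edgeList 6 fun u v => ladderAdj u v || u / 3 == v / 3)
      (fun i => [0, 1, 2, 2, 2, 2].getD i 0) ≠ 0 := by
  decide +kernel

lemma edgeCoeff_ladder_four :
    edgeCoeff (edgeList 8 fun u v => ladderAdj u v || u / 3 == v / 3)
      (fun i => [1, 1, 2, 2, 2, 2, 1, 1].getD i 0) ≠ 0 := by
  decide +kernel

lemma edgeCoeff_ladder_five :
    edgeCoeff (edgeList 10 fun u v => ladderAdj u v ||
        [0, 0, 0, 1, 1, 1, 2, 3, 2, 2].getD u 0 == [0, 0, 0, 1, 1, 1, 2, 3, 2, 2].getD v 0)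
      (fun i => [1, 1, 2, 2, 2, 2, 2, 2, 1, 1].getD i 0) ≠ 0 := by
  decide +kernel

lemma edgeCoeff_ladder_six :
    edgeCoeff (edgeList 12 fun u v => ladderAdj u v || u / 3 == v / 3)
      (fun i => [1, 1, 2, 2, 2, 2, 2, 2, 2, 2, 1, 1].getD i 0) ≠ 0 := by
  decide +kernel

/-- Adjacency `u ~ v`, for `u < v < 2 * n`, in the prism whose `i`-th rung joins `2 * i` and
`2 * i + 1`. -/
def prismAdj (n u v : ℕ) : Bool := ladderAdj u v || v == u + (2 * n - 2)

lemma prismAdj_iff {n u v : ℕ} :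
    prismAdj n u v ↔ v = u + 2 ∨ (v = u + 1 ∧ u % 2 = 0) ∨ v = u + (2 * n - 2) := by
  simp [prismAdj, ladderAdj, or_assoc]

lemma edgeCoeff_prism_three :
    edgeCoeff (edgeList 6 fun u v => prismAdj 3 u v || u / 3 == v / 3)
      (fun i => [2, 2, 1, 2, 2, 2].getD i 0) ≠ 0 := by
  decide +kernel

lemma edgeCoeff_prism_four :
    edgeCoeff (edgeList 8 fun u v => prismAdj 4 u v || u / 3 == v / 3)
      (fun i => [2, 2, 2, 0, 2, 2, 2, 2].getD i 0) ≠ 0 := by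
  decide +kernel

lemma edgeCoeff_prism_five :
    edgeCoeff (edgeList 10 fun u v => prismAdj 5 u v || u / 3 == v / 3)
      (fun i => [2, 2, 2, 0, 2, 2, 2, 2, 2, 2].getD i 0) ≠ 0 := by
  decide +kernel

lemma edgeCoeff_prism_six :
    edgeCoeff (edgeList 12 fun u v => prismAdj 6 u v || u / 3 == v / 3)
      (fun i => [2, 2, 2, 2, 2, 1, 1, 2, 2, 2, 2, 2].getD i 0) ≠ 0 := by
  decide +kernel

/-- If all lists have three colors, the ladder with `3 * k` rungs has a proper coloring from the
lists in which any three consecutive vertices `3 * i, 3 * i + 1, 3 * i + 2` are colored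
differently. -/
lemma exists_listColoring_ladder {α : Type*} [Nonempty α] (ℓ : ℕ → Finset α)
    (hℓ : ∀ v, (ℓ v).card = 3) (k : ℕ) :
    ∃ f : ℕ → α, (∀ v < 6 * k, f v ∈ ℓ v) ∧ ∀ u v, u < v → v < 6 * k →
      (ladderAdj u v ∨ u / 3 = v / 3) → f u ≠ f v := by
  classical
  induction k with
  | zero => exact ⟨fun _ => Classical.arbitrary α, by simp, by simp⟩
  | succ k ih =>
    obtain ⟨f, hf, hne⟩ := ih
    obtain ⟨g, hg, hgne⟩ := exists_listColoring_of_edgeList 6 _ _ edgeCoeff_ladder_three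
      (fun i => if i < 2 then (ℓ (6 * k + i)).erase (f (6 * k + i - 2)) else ℓ (6 * k + i))
      (fun i hi => by
        have hd : ∀ i < 6, [0, 1, 2, 2, 2, 2].getD i 0 < if i < 2 then 2 else 3 := by decide
        refine (hd i hi).trans_le ?_
        have h := Finset.pred_card_le_card_erase (s := ℓ (6 * k + i)) (a := f (6 * k + i - 2))
        rw [hℓ] at h
        split_ifs
        exacts [h, (hℓ _).ge])
    refine ⟨fun v => if v < 6 * k then f v else g (v - 6 * k), fun v hv => ?_,
      fun u v huv hv h => ?_⟩
    · by_cases hvk : v < 6 * k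
      · simpa [hvk] using hf v hvk
      · have := hg (v - 6 * k) (by omega)
        rw [show 6 * k + (v - 6 * k) = v by omega] at this
        simp only [hvk, if_false]
        split_ifs at this
        exacts [Finset.mem_of_mem_erase this, this]
    · by_cases hvk : v < 6 * k
      · simpa [hvk, huv.trans hvk] using hne u v huv hvk h
      · rw [ladderAdj_iff] at h
        by_cases huk : u < 6 * k
        · have := hg (v - 6 * k) (by omega)
          rw [if_pos (by omega), show 6 * k + (v - 6 * k) - 2 = u by omega] at this
          simpa [hvk, huk] using (Finset.ne_of_mem_erase this).symm
        · have := hgne (u - 6 * k) (v - 6 * k) (by omega) (by omega) (by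
            rw [Bool.or_eq_true, ladderAdj_iff, beq_iff_eq]
            omega)
          simpa [hvk, huk] using this

/-- `f` is a proper coloring of the `n`-prism from the lists `ℓ`, and the vertices are partitioned
into `⌈2 * n / 3⌉` sets on each of which `f` is injective. -/
def IsPrismColoring {α : Type*} (n : ℕ) (ℓ : ℕ → Finset α) (f : ℕ → α) : Prop :=
  (∀ v < 2 * n, f v ∈ ℓ v) ∧
  (∀ u v, u < v → v < 2 * n → prismAdj n u v → f u ≠ f v) ∧
  ∃ κ : ℕ → ℕ, (∀ v < 2 * n, κ v < (2 * n + 2) / 3) ∧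
    ∀ u v, u < v → v < 2 * n → κ u = κ v → f u ≠ f v

/-- A colored ladder with `3 * k` rungs can be closed up to a colored prism by `m` more rungs,
if the ladder with `m` rungs is colorable from lists that have one color less at its four corners
than elsewhere. -/
lemma exists_isPrismColoring_of_ladder {α : Type*} [Nonempty α] (ℓ : ℕ → Finset α)
    (hℓ : ∀ v, (ℓ v).card = 3) (m : ℕ) (hm : 2 ≤ m) (κ : ℕ → ℕ)
    (hκ : ∀ i < 2 * m, κ i < (2 * m + 2) / 3) (d : List ℕ)
    (hd : ∀ i < 2 * m, d.getD i 0 < if i < 2 ∨ 2 * m - 2 ≤ i then 2 else 3)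
    (hcoeff : edgeCoeff (edgeList (2 * m) fun u v => ladderAdj u v || κ u == κ v)
      (fun i => d.getD i 0) ≠ 0) (k : ℕ) (hk : 1 ≤ k) :
    ∃ f, IsPrismColoring (3 * k + m) ℓ f := by
  classical
  obtain ⟨f, hf, hne⟩ := exists_listColoring_ladder ℓ hℓ k
  obtain ⟨g, hg, hgne⟩ := exists_listColoring_of_edgeList (2 * m) _ _ hcoeff
    (fun i => if i < 2 ∨ 2 * m - 2 ≤ i then
        (ℓ (6 * k + i)).erase (f (if i < 2 then 6 * k + i - 2 else i - (2 * m - 2)))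
      else ℓ (6 * k + i))
    (fun i hi => by
      refine (hd i hi).trans_le ?_
      have h := Finset.pred_card_le_card_erase (s := ℓ (6 * k + i))
        (a := f (if i < 2 then 6 * k + i - 2 else i - (2 * m - 2)))
      rw [hℓ] at h
      by_cases hi2 : i < 2 ∨ 2 * m - 2 ≤ i
      · rw [if_pos hi2, if_pos hi2]
        exact h
      · rw [if_neg hi2, if_neg hi2]
        exact (hℓ _).ge)
  refine ⟨fun v => if v < 6 * k then f v else g (v - 6 * k), fun v hv => ?_,
    fun u v huv hv h => ?_, fun v => if v < 6 * k then v / 3 else 2 * k + κ (v - 6 * k),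
    fun v hv => ?_, fun u v huv hv h => ?_⟩
  · by_cases hvk : v < 6 * k
    · simpa [hvk] using hf v hvk
    · have := hg (v - 6 * k) (by omega)
      rw [show 6 * k + (v - 6 * k) = v by omega] at this
      simp only [hvk, if_false]
      by_cases hi2 : v - 6 * k < 2 ∨ 2 * m - 2 ≤ v - 6 * k
      · rw [if_pos hi2] at this
        exact Finset.mem_of_mem_erase this
      · rwa [if_neg hi2] at this
  · rw [prismAdj_iff] at h
    by_cases hvk : v < 6 * k
    · have := hne u v huv hvk (Or.inl (ladderAdj_iff.mpr (by omega)))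
      simpa [hvk, huv.trans hvk] using this
    · by_cases huk : u < 6 * k
      · have := hg (v - 6 * k) (by omega)
        rw [if_pos (by omega), show (if v - 6 * k < 2 then 6 * k + (v - 6 * k) - 2
          else v - 6 * k - (2 * m - 2)) = u by split_ifs <;> omega] at this
        simpa [hvk, huk] using (Finset.ne_of_mem_erase this).symm
      · have := hgne (u - 6 * k) (v - 6 * k) (by omega) (by omega) (by
          rw [Bool.or_eq_true, ladderAdj_iff]
          omega)
        simpa [hvk, huk] using this
  · dsimp only
    split_ifs with hvk
    · omega
    · have := hκ (v - 6 * k) (by omega)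
      omega
  · dsimp only at h
    by_cases hvk : v < 6 * k
    · have huk := huv.trans hvk
      rw [if_pos huk, if_pos hvk] at h
      simpa [hvk, huk] using hne u v huv hvk (Or.inr h)
    · by_cases huk : u < 6 * k
      · rw [if_pos huk, if_neg hvk] at h
        omega
      · rw [if_neg huk, if_neg hvk] at h
        have := hgne (u - 6 * k) (v - 6 * k) (by omega) (by omega) (by
          rw [Bool.or_eq_true, beq_iff_eq]
          omega)
        simpa [hvk, huk] using this

lemma exists_isPrismColoring_of_edgeCoeff {α : Type*} [Nonempty α] (ℓ : ℕ → Finset α)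
    (hℓ : ∀ v, (ℓ v).card = 3) (n : ℕ) (d : List ℕ) (hd : ∀ i < 2 * n, d.getD i 0 < 3)
    (hcoeff : edgeCoeff (edgeList (2 * n) fun u v => prismAdj n u v || u / 3 == v / 3)
      (fun i => d.getD i 0) ≠ 0) :
    ∃ f, IsPrismColoring n ℓ f := by
  obtain ⟨f, hf, hne⟩ := exists_listColoring_of_edgeList (2 * n) _ _ hcoeff ℓ
    fun i hi => by rw [hℓ]; exact hd i hi
  exact ⟨f, hf, fun u v huv hv h => hne u v huv hv (by simp [h]), fun v => v / 3,
    fun v hv => by dsimp only; omega, fun u v huv hv h => hne u v huv hv (by simpa using Or.inr h)⟩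

lemma exists_isPrismColoring {α : Type*} [Nonempty α] (ℓ : ℕ → Finset α)
    (hℓ : ∀ v, (ℓ v).card = 3) (n : ℕ) (hn : 3 ≤ n) : ∃ f, IsPrismColoring n ℓ f := by
  by_cases h7 : 7 ≤ n
  · obtain ⟨k, hk, h | h | h⟩ : ∃ k, 1 ≤ k ∧ (n = 3 * k + 4 ∨ n = 3 * k + 5 ∨ n = 3 * k + 6) :=
      ⟨(n - 4) / 3, by omega, by omega⟩
    · exact h ▸ exists_isPrismColoring_of_ladder ℓ hℓ 4 (by decide) (fun v => v / 3) (by decide) _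
        (by decide) edgeCoeff_ladder_four k hk
    · exact h ▸ exists_isPrismColoring_of_ladder ℓ hℓ 5 (by decide)
        (fun v => [0, 0, 0, 1, 1, 1, 2, 3, 2, 2].getD v 0) (by decide) _
        (by decide) edgeCoeff_ladder_five k hk
    · exact h ▸ exists_isPrismColoring_of_ladder ℓ hℓ 6 (by decide) (fun v => v / 3) (by decide) _
        (by decide) edgeCoeff_ladder_six k hk
  · obtain rfl | rfl | rfl | rfl : n = 3 ∨ n = 4 ∨ n = 5 ∨ n = 6 := by omega
    · exact exists_isPrismColoring_of_edgeCoeff ℓ hℓ 3 _ (by decide) edgeCoeff_prism_three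
    · exact exists_isPrismColoring_of_edgeCoeff ℓ hℓ 4 _ (by decide) edgeCoeff_prism_four
    · exact exists_isPrismColoring_of_edgeCoeff ℓ hℓ 5 _ (by decide) edgeCoeff_prism_five
    · exact exists_isPrismColoring_of_edgeCoeff ℓ hℓ 6 _ (by decide) edgeCoeff_prism_six

/-- The number `2 * i + j` of the vertex `(i, j)` of the prism. -/
def vertexCode {n : ℕ} (x : Fin n × Fin 2) : ℕ := 2 * x.1 + x.2

lemma vertexCode_lt {n : ℕ} (x : Fin n × Fin 2) : vertexCode x < 2 * n := by
  have := x.1.isLt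
  have := x.2.isLt
  unfold vertexCode
  omega

lemma vertexCode_injective {n : ℕ} : Function.Injective (vertexCode (n := n)) := by
  rintro ⟨⟨a, ha⟩, ⟨b, hb⟩⟩ ⟨⟨a', ha'⟩, ⟨b', hb'⟩⟩ h
  simp only [vertexCode, Prod.mk.injEq, Fin.mk.injEq] at h ⊢
  omega

lemma prismAdj_vertexCode {n : ℕ} (hn : 3 ≤ n) {x y : Fin n × Fin 2}
    (h : (prismGraph n).Adj x y) (hlt : vertexCode x < vertexCode y) :
    prismAdj n (vertexCode x) (vertexCode y) := by
  obtain ⟨⟨a, ha⟩, ⟨b, hb⟩⟩ := x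
  obtain ⟨⟨a', ha'⟩, ⟨b', hb'⟩⟩ := y
  rw [prismAdj_iff]
  simp only [prismGraph, SimpleGraph.boxProd_adj, SimpleGraph.cycleGraph_adj', Fin.sub_def,
    Fin.mk.injEq, vertexCode] at h hlt ⊢
  rcases h with ⟨h, rfl⟩ | ⟨-, rfl⟩
  · have key : ∀ p q : ℕ, p < n → q < n → (n - q + p) % n = 1 →
        p = q + 1 ∨ (p = 0 ∧ q = n - 1) := by
      intro p q hp hq hpq
      rcases lt_or_ge (n - q + p) n with hlt | hge
      · rw [Nat.mod_eq_of_lt hlt] at hpq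
        omega
      · rw [Nat.mod_eq_sub_mod hge, Nat.mod_eq_of_lt (by omega)] at hpq
        omega
    rcases h with h | h
    · have := key _ _ ha ha' h
      omega
    · have := key _ _ ha' ha h
      omega
  · omega

theorem theorem1p6 (n : ℕ) (hn : 3 ≤ n) : EquitablyChoosable.{0, w} (prismGraph n) 3 := by
  intro α L hL
  have : NeZero n := ⟨by omega⟩
  obtain ⟨a₀, -⟩ := Finset.card_pos.mp (by rw [hL (0, 0)]; norm_num : 0 < (L (0, 0)).card)
  have : Nonempty α := ⟨a₀⟩
  obtain ⟨f, hf, hne, κ, hκ, hκne⟩ := exists_isPrismColoring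
    (fun v => L (Fin.ofNat n (v / 2), Fin.ofNat 2 v)) (fun v => hL _) n hn
  refine ⟨SimpleGraph.Coloring.mk (fun x => f (vertexCode x)) fun {x y} h => ?_, fun x => ?_,
    fun a => ?_⟩
  · rcases lt_trichotomy (vertexCode x) (vertexCode y) with hlt | heq | hlt
    · exact hne _ _ hlt (vertexCode_lt y) (prismAdj_vertexCode hn h hlt)
    · exact absurd (vertexCode_injective heq) h.ne
    · exact (hne _ _ hlt (vertexCode_lt x) (prismAdj_vertexCode hn h.symm hlt)).symm
  · have hx : (Fin.ofNat n (vertexCode x / 2), Fin.ofNat 2 (vertexCode x)) = x := by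
      obtain ⟨⟨a, ha⟩, ⟨b, hb⟩⟩ := x
      simp only [vertexCode, Fin.ofNat, Prod.mk.injEq, Fin.mk.injEq]
      rw [show (2 * a + b) / 2 = a by omega, Nat.mod_eq_of_lt ha]
      omega
    have := hf _ (vertexCode_lt x)
    dsimp only at this
    rwa [hx] at this
  · have hle : (2 * n + 2) / 3 ≤ ⌈(Nat.card (Fin n × Fin 2) : ℚ) / ((3 : ℕ) : ℚ)⌉₊ := by
      have h := Nat.le_ceil ((Nat.card (Fin n × Fin 2) : ℚ) / ((3 : ℕ) : ℚ))
      rw [div_le_iff₀ (by norm_num)] at h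
      norm_cast at h
      rw [Nat.card_prod, Nat.card_fin, Nat.card_fin] at h ⊢
      push_cast at h ⊢
      omega
    refine le_trans ?_ hle
    rw [← Finset.card_range ((2 * n + 2) / 3), ← Set.ncard_coe_finset]
    refine Set.ncard_le_ncard_of_injOn (fun x => κ (vertexCode x))
      (fun x _ => by simpa using hκ _ (vertexCode_lt x)) (fun x hx y hy hxy => ?_)
      (Finset.finite_toSet _)
    have hfxy : f (vertexCode x) = f (vertexCode y) := Eq.trans hx (Eq.symm hy)
    rcases lt_trichotomy (vertexCode x) (vertexCode y) with hlt | heq | hlt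
    · exact absurd hfxy (hκne _ _ hlt (vertexCode_lt y) hxy)
    · exact vertexCode_injective heq
    · exact absurd hfxy.symm (hκne _ _ hlt (vertexCode_lt x) hxy.symm)
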